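/- **Setting.** For each $\theta\in\mathbb R^{d_\theta}$ let $\rho_\theta$ be a Lebesgue-integrable function on $\mathbb R^{d_x}$; put $Z_\theta=\int\rho_\theta(x)\,dx$, $\pi_\theta=\rho_\theta/Z_\theta$, $\ell(\theta;x)=\log\rho_\theta(x)$, and $\mathcal O_\star=\operatorname{argmax}_\theta Z_\theta$. Let $\mathcal P_2$ be the set of Borel probability measures on $\mathbb R^{d_x}$ with a Lebesgue density and finite second moment, and let $\mathcal P_2^1\subset\mathcal P_2$ be the set of those with a locally Lipschitz density (the same symbol denotes a measure and its density). For $\theta\in\mathbb R^{d_\theta}$ and a probability measure $q$ define the free energy $F(\theta,q)=\int\log\frac{q(x)}{\rho_\theta(x)}\,q(dx)$ if $q\ll\rho_\theta(x)dx$ and $F(\theta,q)=+\infty$ otherwise, let $F_\star=\inf_{\mathbb R^{d_\theta}\times\mathcal P_2}F$, and for $q\in\mathcal P_2^1$ let $$I(\theta,q)=\Big\|\int\nabla_\theta\ell(\theta;x)\,q(dx)\Big\|^2+\int\Big\|\nabla_x\log\frac{q(x)}{\rho_\theta(x)}\Big\|^2q(dx).$$ **Assumptions.** (1) For every $x$ the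 map $\theta\mapsto\pi_\theta(x)$ is differentiable, and $\theta\mapsto Z_\theta$ is differentiable; every $\pi_\theta$ is twice continuously differentiable; $\rho_\theta(x)>0$ for all $\theta,x$; every $\pi_\theta$ has a finite second moment, and it is continuous in $\theta$; $\mathcal O_\star$ is compact. (2) $\ell$ is differentiable and, for constants $L_\theta,L_x>0$ and all $\theta,\theta',x,x'$, $\ \|\nabla\ell(\theta;x)-\nabla\ell(\theta';x')\|\le L_\theta\|\theta-\theta'\|+L_x\|x-x'\|$, where $\nabla\ell=(\nabla_\theta\ell,\nabla_x\ell)$. (3) (xLSI with constant $\lambda>0$) $\ 2\lambda[F(\theta,q)-F_\star]\le I(\theta,q)$ for all $(\theta,q)\in\mathbb R^{d_\theta}\times\mathcal P_2^1$. **EM iterates.** Let $\theta_0\in\mathbb R^{d_\theta}$ and $q_0\in\mathcal P_2$ be arbitrary and, for $k\ge0$, let $\theta_{k+1}\in\operatorname{argmax}_\theta\int\ell(\theta;x)\,q_k(dx)$ and $q_{k+1}=\pi_{\theta_{k+1}}$. Let $(\theta_\dagger,x_\dagger)$ be a stationary point of $\ell$, let $L=\max(L_\theta,L_x)$, and put $$C=L^2\sup_{k\ge0}\Big\{\int\|x-x_\dagger\|^2q_k(dx)+\|\theta_{k+1}-\theta_\dagger\|^2\Big\},\qquad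 B=8L_x^2d_x+\frac{C L_x}{2}.$$ **Theorem.** Under (1)–(3), $C$ is finite and, for every integer $k\ge0$, $$F(\theta_k,q_k)-F_\star\le\inf_{0\le h\le 1/(4L_x)}\Big\{e^{-k\lambda(h+1/L_\theta)}\,[F(\theta_0,q_0)-F_\star]+\frac{h^2B}{1-e^{-\lambda(h+1/L_\theta)}}\Big\}.$$ -/

import Mathlib

open MeasureTheory

noncomputable section

/-- The Euclidean space of dimension `d`. -/
abbrev Euc (d : ℕ) : Type := EuclideanSpace ℝ (Fin d)

/-- The measure with Lebesgue density `p`. -/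
def densityMeasure {d : ℕ} (p : Euc d → ℝ) : Measure (Euc d) :=
  volume.withDensity (fun x => ENNReal.ofReal (p x))

/-- The marginal likelihood `Z_θ = ∫ ρ_θ(x) dx`. -/
def marginal {m d : ℕ} (ρ : Euc m → Euc d → ℝ) (θ : Euc m) : ℝ := ∫ x, ρ θ x

/-- The posterior density `π_θ(x) = ρ_θ(x) / Z_θ`. -/
def posterior {m d : ℕ} (ρ : Euc m → Euc d → ℝ) (θ : Euc m) (x : Euc d) : ℝ :=
  ρ θ x / marginal ρ θ

/-- The complete-data log-likelihood `ℓ(θ; x) = log ρ_θ(x)`. -/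
def logLik {m d : ℕ} (ρ : Euc m → Euc d → ℝ) (θ : Euc m) (x : Euc d) : ℝ :=
  Real.log (ρ θ x)

/-- The partial gradient `∇_θ ℓ(θ; x)`. -/
def gradParam {m d : ℕ} (ρ : Euc m → Euc d → ℝ) (θ : Euc m) (x : Euc d) : Euc m :=
  gradient (fun ϑ => logLik ρ ϑ x) θ

/-- The partial gradient `∇_x ℓ(θ; x)`. -/
def gradLatent {m d : ℕ} (ρ : Euc m → Euc d → ℝ) (θ : Euc m) (x : Euc d) : Euc d :=
  gradient (fun y => logLik ρ θ y) x

/-- The maximisers of the marginal likelihood. -/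
def optimalParams {m d : ℕ} (ρ : Euc m → Euc d → ℝ) : Set (Euc m) :=
  {θ | ∀ ϑ, marginal ρ ϑ ≤ marginal ρ θ}

/-- Borel probability measures that have a Lebesgue density and a finite second moment. -/
structure IsP2 {d : ℕ} (q : Measure (Euc d)) : Prop where
  prob : IsProbabilityMeasure q
  ac : q ≪ volume
  second_moment : Integrable (fun x => ‖x‖ ^ 2) q

/-- `p` is a locally Lipschitz (hence a.e. differentiable, by Rademacher) density of a
probability measure with finite second moment. -/
structure IsP21Density {d : ℕ} (p : Euc d → ℝ) : Prop where
  nonneg : ∀ x, 0 ≤ p x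
  locallyLipschitz : LocallyLipschitz p
  isP2 : IsP2 (densityMeasure p)

open Classical in
/-- The free energy `F(θ, q) = ∫ log (q(x) / ρ_θ(x)) q(dx)` if `q ≪ ρ_θ(dx)`, and `+∞` otherwise.
When `ρ_θ` is integrable, the negative part of the integrand is always `q`-integrable (because
`t log t ≥ -1/e`), so an integrand that is not integrable has integral `+∞`. -/
def freeEnergy {m d : ℕ} (ρ : Euc m → Euc d → ℝ) (θ : Euc m) (q : Measure (Euc d)) : EReal :=
  if q ≪ densityMeasure (ρ θ) ∧
      Integrable (fun x => Real.log ((q.rnDeriv volume x).toReal / ρ θ x)) q then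
    ((∫ x, Real.log ((q.rnDeriv volume x).toReal / ρ θ x) ∂q : ℝ) : EReal)
  else ⊤

/-- The infimum `F_⋆` of the free energy over all `θ` and all `q` in `P_2`. -/
def freeEnergyInf {m d : ℕ} (ρ : Euc m → Euc d → ℝ) : EReal :=
  ⨅ (θ : Euc m) (q : Measure (Euc d)) (_ : IsP2 q), freeEnergy ρ θ q

/-- The extended Fisher information
`I(θ, q) = ‖∫ ∇_θ ℓ(θ; x) q(dx)‖² + ∫ ‖∇_x log (q(x) / ρ_θ(x))‖² q(dx)`
of the measure with density `p`. -/
def extFisher {m d : ℕ} (ρ : Euc m → Euc d → ℝ) (θ : Euc m) (p : Euc d → ℝ) : ENNReal :=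
  ENNReal.ofReal (‖∫ x, gradParam ρ θ x ∂(densityMeasure p)‖ ^ 2) +
    ∫⁻ x, ENNReal.ofReal (‖gradient (fun y => Real.log (p y / ρ θ y)) x‖ ^ 2) ∂(densityMeasure p)

/-- The extended log-Sobolev inequality with constant `lam`. -/
def XLSI {m d : ℕ} (ρ : Euc m → Euc d → ℝ) (lam : ℝ) : Prop :=
  ∀ (θ : Euc m) (p : Euc d → ℝ), IsP21Density p →
    ((2 * lam : ℝ) : EReal) * (freeEnergy ρ θ (densityMeasure p) - freeEnergyInf ρ) ≤
      ((extFisher ρ θ p : ENNReal) : EReal)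

/-- The regularity assumptions on the model. -/
structure ModelRegular {m d : ℕ} (ρ : Euc m → Euc d → ℝ) : Prop where
  integrable : ∀ θ, Integrable (ρ θ)
  posterior_differentiable : ∀ x, Differentiable ℝ (fun θ => posterior ρ θ x)
  marginal_differentiable : Differentiable ℝ (marginal ρ)
  posterior_contDiff : ∀ θ, ContDiff ℝ 2 (posterior ρ θ)
  pos : ∀ θ x, 0 < ρ θ x
  second_moment : ∀ θ, Integrable (fun x => ‖x‖ ^ 2 * posterior ρ θ x)
  second_moment_continuous : Continuous (fun θ => ∫ x, ‖x‖ ^ 2 * posterior ρ θ x)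
  optimal_compact : IsCompact (optimalParams ρ)

/-- `ℓ` is differentiable and `‖∇ℓ(θ; x) - ∇ℓ(θ'; x')‖ ≤ L_θ ‖θ - θ'‖ + L_x ‖x - x'‖`, where the
left side is the Euclidean norm of the joint gradient `∇ℓ = (∇_θ ℓ, ∇_x ℓ)`. -/
structure GradLipschitz {m d : ℕ} (ρ : Euc m → Euc d → ℝ) (Lθ Lx : ℝ) : Prop where
  differentiable : Differentiable ℝ (fun z : Euc m × Euc d => logLik ρ z.1 z.2)
  lipschitz : ∀ (θ θ' : Euc m) (x x' : Euc d),
    Real.sqrt (‖gradParam ρ θ x - gradParam ρ θ' x'‖ ^ 2 +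
        ‖gradLatent ρ θ x - gradLatent ρ θ' x'‖ ^ 2) ≤
      Lθ * ‖θ - θ'‖ + Lx * ‖x - x'‖

/-- `(θ_k, q_k)` are iterates of the EM algorithm: each `θ_{k+1}` is a maximiser of
`θ ↦ ∫ ℓ(θ; x) q_k(dx)` (M-step), and `q_{k+1} = π_{θ_{k+1}}` (E-step). The initial pair is an
arbitrary element of `ℝ^m × P_2`. -/
structure IsEMSequence {m d : ℕ} (ρ : Euc m → Euc d → ℝ) (θ : ℕ → Euc m)
    (q : ℕ → Measure (Euc d)) : Prop where
  init : IsP2 (q 0)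
  mStep : ∀ k ϑ, ∫ x, logLik ρ ϑ x ∂(q k) ≤ ∫ x, logLik ρ (θ (k + 1)) x ∂(q k)
  eStep : ∀ k, q (k + 1) = densityMeasure (posterior ρ (θ (k + 1)))

/-- `(θd, xd)` is a stationary point of `ℓ`. -/
def IsStationaryPoint {m d : ℕ} (ρ : Euc m → Euc d → ℝ) (θd : Euc m) (xd : Euc d) : Prop :=
  gradParam ρ θd xd = 0 ∧ gradLatent ρ θd xd = 0

/-- The quantity `∫ ‖x - xd‖² q_k(dx) + ‖θ_{k+1} - θd‖²`. -/
def iterateSpread {m d : ℕ} (θ : ℕ → Euc m) (q : ℕ → Measure (Euc d)) (θd : Euc m) (xd : Euc d)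
    (k : ℕ) : ℝ :=
  (∫ x, ‖x - xd‖ ^ 2 ∂(q k)) + ‖θ (k + 1) - θd‖ ^ 2

/-- The constant `C = L² sup_k {∫ ‖x - xd‖² q_k(dx) + ‖θ_{k+1} - θd‖²}`, `L = max(L_θ, L_x)`. -/
def constC {m d : ℕ} (θ : ℕ → Euc m) (q : ℕ → Measure (Euc d)) (θd : Euc m) (xd : Euc d)
    (Lθ Lx : ℝ) : ℝ :=
  (max Lθ Lx) ^ 2 * ⨆ k, iterateSpread θ q θd xd k

/-- The constant `B = 8 L_x² d_x + C L_x / 2`. -/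
def constB {m d : ℕ} (θ : ℕ → Euc m) (q : ℕ → Measure (Euc d)) (θd : Euc m) (xd : Euc d)
    (Lθ Lx : ℝ) : ℝ :=
  8 * Lx ^ 2 * d + constC θ q θd xd Lθ Lx * Lx / 2

end

/-! Put f(θ) = -log Z_θ, which equals F(θ, π_θ) = min_q F(θ, q). At q = π_θ the x-part of the Fisher
information vanishes and ∇f(θ) = -∫ ∇_θ ℓ dπ_θ, so xLSI becomes the gradient domination 2λ(f - F_⋆)
≤ ‖∇f‖².

Let r = λ/L_θ. Each half-step contracts the gap by 1 - r. For the M-step from a posterior,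
smoothness gains ‖∇f‖²/(2L_θ) (`GradLipschitz.sq_norm_integral_gradParam_le`). For the E-step, the
expected gradient vanishes at the maximiser θ_{k+1}, so f lies below the parabola F(θ_{k+1}, q_k) +
(L_θ/2)‖· - θ_{k+1}‖²; gradient domination makes √(f - F_⋆) grow at slope √(λ/2) in some direction,
which forces f(θ_{k+1}) well below the parabola's vertex (`sub_le_of_forall_le_add_sq`). An
arbitrary q_0 yields only one factor 1 - r in the first iteration; later ones yield (1 - r)² ≤
e^{-2r}.

The claimed factor e^{-(r + λh)} may be smaller than these. The excess is absorbed by the term in B,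
through the a priori bound L_x L_θ S/λ on the gap, S being the supremum in C
(`sq_norm_integral_gradParam_le_of_spread`, `le_rate_of_contractions`). S is finite because gradient
domination bounds the distance to the compact set of minimisers. -/

/-! ### Scalar inequalities for the first iteration. -/

theorem quadratic_le_sq_of_log_bounds (r x : ℝ) (hr : 0 < r) (hx : 0 ≤ x) :
    2*r^2*x+2*r*(1-r)*x^2 ≤ (x+x^2/2+r^2/2+r^3/3)^2 := by
  -- The difference of the two sides without the nonnegative terms x³, x⁴/4, x²r³/3, r⁶/9: a
  -- quadratic in x. In its discriminant the r⁴ terms cancel, so the sign is decided at order r⁵.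
  have h1 : 0 ≤ x^2*(1-2*r+5*r^2/2) + x*(-r^2+2*r^3/3) + r^4/4+r^5/3 := by
    have ha : 0 < 1-2*r+5*r^2/2 := by nlinarith [sq_nonneg (r-2/5)]
    have : 0 ≤ 4*(1-2*r+5*r^2/2)*(x^2*(1-2*r+5*r^2/2) + x*(-r^2+2*r^3/3) + r^4/4+r^5/3) := by
      have e : 4*(1-2*r+5*r^2/2)*(x^2*(1-2*r+5*r^2/2) + x*(-r^2+2*r^3/3) + r^4/4+r^5/3)
        = (2*(1-2*r+5*r^2/2)*x + (-r^2+2*r^3/3))^2 + r^5*(2/3 - 11/18*r+10/3*r^2) := by ring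
      rw [e]
      have : 0 ≤ 2/3 - 11/18*r+10/3*r^2 := by nlinarith
      positivity
    exact nonneg_of_mul_nonneg_right this (by positivity)
  nlinarith [show 0 ≤ x^3 + x^4/4 by positivity, show 0 ≤ x^2*r^3/3 by positivity, show 0 ≤ r^6/9 by positivity]

/-- Write e^{-t} = (1-r)(1-x) with 0 ≤ x < 1. Then t = -log(1-r) - log(1-x), and truncating both
logarithmic series bounds t - r below by a polynomial. -/
theorem one_sub_exp_mul_le_sq (r t : ℝ) (hr : 0 < r) (hr1 : r < 1) (hE : Real.exp (-t) ≤ 1 - r) :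
    2*r*(1-Real.exp (-t))*(1-r-Real.exp (-t)) ≤ (1-r)*(t-r)^2 := by
  have hc : 0 < 1 - r := by linarith
  have key : ∀ y : ℝ, 0 ≤ y → y < 1 → y + y^2/2 + y^3/3 ≤ -Real.log (1-y) := by
    intro y hy hy1
    have h := Real.hasSum_pow_div_log_of_abs_lt_one (x := y) (by rw [abs_of_nonneg hy]; exact hy1)
    have := h.summable.sum_le_tsum (Finset.range 3) (fun i _ => by positivity)
    rw [h.tsum_eq] at this
    simp only [Finset.sum_range_succ, Finset.sum_range_zero] at this
    norm_num at this
    linarith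
  set E := Real.exp (-t) with hEd
  have hE0 : 0 < E := Real.exp_pos _
  obtain ⟨x, hx⟩ : ∃ x, x = 1 - E/(1-r) := ⟨_, rfl⟩
  have hEx : E = (1-r)*(1-x) := by rw [hx]; field_simp; ring
  have hx0 : 0 ≤ x := by rw [hx, sub_nonneg, div_le_one hc]; exact hE
  have hx1 : x < 1 := by rw [hx]; have := div_pos hE0 hc; linarith
  have h1 := key x hx0 hx1
  have h2 := key r hr.le hr1
  have h3 : Real.log E = -t := by rw [hEd, Real.log_exp]
  rw [hEx, Real.log_mul hc.ne' (by linarith)] at h3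
  have h4 : x+x^2/2+r^2/2+r^3/3 ≤ t - r := by
    have : 0 ≤ x^3/3 := by positivity
    linarith
  have h5 : (x+x^2/2+r^2/2+r^3/3)^2 ≤ (t-r)^2 := pow_le_pow_left₀ (by positivity) h4 2
  have h6 := quadratic_le_sq_of_log_bounds r x hr hx0
  rw [hEx]
  have : 2*r^2*x+2*r*(1-r)*x^2 ≤ (t-r)^2 := h6.trans h5
  have := mul_le_mul_of_nonneg_left this hc.le
  linarith

/-! ### Smoothness and gradient domination in Euclidean space. -/

section Calculus

variable {E : Type*} [NormedAddCommGroup E] [InnerProductSpace ℝ E]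

theorem abs_sub_sub_inner_le [CompleteSpace E] {f : E → ℝ} {L : ℝ} (hf : Differentiable ℝ f)
    (hL : ∀ x y, ‖gradient f x - gradient f y‖ ≤ L * ‖x - y‖) (x v : E) :
    |f (x + v) - f x - inner ℝ (gradient f x) v| ≤ L / 2 * ‖v‖ ^ 2 := by
  have hder : ∀ t : ℝ, HasDerivAt (fun t : ℝ => f (x + t • v) - f x - t * inner ℝ (gradient f x) v)
      (inner ℝ (gradient f (x + t • v) - gradient f x) v) t := by
    intro t
    have h1 : HasDerivAt (fun t : ℝ => x + t • v) v t := by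
      simpa using ((hasDerivAt_id t).smul_const v).const_add x
    have h2 := (hf (x + t • v)).hasGradientAt.hasFDerivAt.comp_hasDerivAt t h1
    have h3 := (h2.sub_const (f x)).sub ((hasDerivAt_id t).mul_const (inner ℝ (gradient f x) v))
    rw [inner_sub_left]
    exact h3.congr_deriv (by simp)
  have hB : ∀ t : ℝ, HasDerivAt (fun t : ℝ => L / 2 * t ^ 2 * ‖v‖ ^ 2) (L * t * ‖v‖ ^ 2) t := by
    intro t
    have := (((hasDerivAt_pow 2 t).const_mul (L / 2)).mul_const (‖v‖ ^ 2))
    refine this.congr_deriv ?_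
    push_cast; ring
  have := image_norm_le_of_norm_deriv_right_le_deriv_boundary (a := 0) (b := 1)
    (fun t _ => (hder t).continuousAt.continuousWithinAt)
    (fun t _ => (hder t).hasDerivWithinAt) (by simp) (fun t => hB t)
    (fun t ht => by
      refine (norm_inner_le_norm _ _).trans ?_
      have := hL (x + t • v) x
      rw [add_sub_cancel_left, norm_smul, Real.norm_of_nonneg ht.1] at this
      calc _ ≤ L * (t * ‖v‖) * ‖v‖ := by gcongr
        _ = _ := by ring) (x := 1) (by simp)
  simpa using this

theorem norm_le_of_le_add_norm_sub {w : E → ℝ} {w' : E →L[ℝ] ℝ} {x : E} {s : ℝ} (hs : 0 ≤ s)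
    (hw : HasFDerivAt w w' x) (h : ∀ᶠ y in nhds x, w y ≤ w x + s * ‖y - x‖) : ‖w'‖ ≤ s := by
  have key : ∀ v : E, w' v ≤ s * ‖v‖ := by
    intro v
    have h1 : HasDerivAt (fun t : ℝ => x + t • v) v 0 := by
      simpa using ((hasDerivAt_id (0 : ℝ)).smul_const v).const_add x
    have h2 : HasDerivAt (fun t : ℝ => w (x + t • v)) (w' v) 0 := by
      have hw' : HasFDerivAt w w' (x + (0 : ℝ) • v) := by simpa using hw
      exact hw'.comp_hasDerivAt 0 h1
    have h3 := hasDerivAt_iff_tendsto_slope.1 h2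
    have h4 : Filter.Tendsto (slope (fun t : ℝ => w (x + t • v)) 0) (nhdsWithin 0 (Set.Ioi 0))
        (nhds (w' v)) := h3.mono_left (nhdsWithin_mono _ (by intro y hy; exact ne_of_gt hy))
    refine le_of_tendsto h4 ?_
    have h5 : Filter.Tendsto (fun t : ℝ => x + t • v) (nhdsWithin 0 (Set.Ioi 0)) (nhds x) := by
      have := h1.continuousAt.tendsto
      simp only [zero_smul, add_zero] at this
      exact this.mono_left nhdsWithin_le_nhds
    filter_upwards [h5.eventually h, self_mem_nhdsWithin] with t ht ht0
    have ht0 : 0 < t := ht0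
    rw [slope_def_field]
    simp only [add_sub_cancel_left, norm_smul, Real.norm_of_nonneg ht0.le, zero_smul,
      add_zero, sub_zero] at ht ⊢
    rw [div_le_iff₀ ht0]
    linarith
  refine w'.opNorm_le_bound hs (fun v => ?_)
  rw [Real.norm_eq_abs, abs_le]
  have h1 := key v
  have h2 := key (-v)
  simp only [map_neg, norm_neg] at h2
  constructor <;> linarith

variable [CompleteSpace E]

/-- Gradient domination says that √(f - fs), whose gradient has norm ‖G‖/(2√(f - fs)), has slope at
least √(lam/2) away from the minimum. -/
theorem exists_hasFDerivAt_sqrt_sub {f : E → ℝ} {G : E} {lam fs : ℝ} {x : E}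
    (hf : HasGradientAt f G x) (hPL : 2 * lam * (f x - fs) ≤ ‖G‖ ^ 2) (hx : fs < f x) :
    ∃ w' : E →L[ℝ] ℝ, HasFDerivAt (fun y => √(f y - fs)) w' x ∧ √(lam / 2) ≤ ‖w'‖ := by
  have h0 : 0 < f x - fs := sub_pos.2 hx
  have h1 := (hf.hasFDerivAt.sub_const fs).sqrt h0.ne'
  refine ⟨_, h1, ?_⟩
  have hs := Real.sqrt_pos.2 h0
  rw [norm_smul, LinearIsometryEquiv.norm_map, Real.norm_of_nonneg (by positivity)]
  apply Real.sqrt_le_iff.2 ⟨by positivity, ?_⟩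
  rw [mul_pow, div_pow, mul_pow, Real.sq_sqrt h0.le]
  rw [one_pow, one_div, ← div_eq_inv_mul, le_div_iff₀ (by positivity)]
  linarith

variable [FiniteDimensional ℝ E]

/-- Maximise √(f - fs) - σ‖· - x‖ over the ball of radius s. At an interior maximiser the slope of
√(f - fs) would be at most σ < √(lam/2), so the maximiser lies on the sphere. -/
theorem exists_sqrt_sub_ge {f : E → ℝ} {G : E → E} {lam fs s σ : ℝ}
    (hf : ∀ x, HasGradientAt f (G x) x) (hPL : ∀ x, 2 * lam * (f x - fs) ≤ ‖G x‖ ^ 2)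
    (x : E) (hx : fs < f x) (hσ0 : 0 ≤ σ) (hσ : σ < √(lam / 2)) (hs : 0 ≤ s) :
    ∃ y, ‖y - x‖ = s ∧ √(f x - fs) + σ * s ≤ √(f y - fs) := by
  have hc : Continuous f := continuous_iff_continuousAt.2 fun x =>
    (hf x).hasFDerivAt.continuousAt
  obtain ⟨z, hz, hmax⟩ := (isCompact_closedBall x s).exists_isMaxOn
    ⟨x, Metric.mem_closedBall_self hs⟩
    (f := fun y => √(f y - fs) - σ * ‖y - x‖) (by fun_prop)
  have hmax' : ∀ y, ‖y - x‖ ≤ s → √(f y - fs) - σ * ‖y - x‖ ≤ √(f z - fs) - σ * ‖z - x‖ :=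
    fun y hy => hmax (by simpa [dist_eq_norm] using hy)
  have hxz := hmax' x (by simpa using hs)
  simp only [sub_self, norm_zero, mul_zero, sub_zero] at hxz
  have hzs : ‖z - x‖ ≤ s := by simpa [dist_eq_norm] using hz
  rcases hzs.eq_or_lt with h | h
  · exact ⟨z, h, by rw [← h]; linarith⟩
  exfalso
  have hpos : 0 < √(f x - fs) := Real.sqrt_pos.2 (sub_pos.2 hx)
  have hfz : fs < f z := by
    have : 0 < √(f z - fs) := by have := mul_nonneg hσ0 (norm_nonneg (z - x)); linarith
    exact sub_pos.1 (Real.sqrt_pos.1 this)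
  obtain ⟨w', hw', hn⟩ := exists_hasFDerivAt_sqrt_sub (hf z) (hPL z) hfz
  have := norm_le_of_le_add_norm_sub hσ0 hw' (by
    have : ∀ᶠ y in nhds z, ‖y - x‖ < s :=
      (continuous_norm.comp (continuous_id.sub continuous_const)).continuousAt.eventually_lt_const h
    filter_upwards [this] with y hy
    have h1 := hmax' y hy.le
    have h2 := norm_sub_le_norm_sub_add_norm_sub y z x
    have h3 := mul_le_mul_of_nonneg_left h2 hσ0
    linarith)
  linarith

/-- The descending counterpart: √(f - fs) + σ‖· - x‖ is coercive, and at its minimiser a positive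
gap would again force a slope at most σ. -/
theorem exists_eq_of_gradient_dominated {f : E → ℝ} {G : E → E} {lam fs σ : ℝ}
    (hf : ∀ x, HasGradientAt f (G x) x) (hPL : ∀ x, 2 * lam * (f x - fs) ≤ ‖G x‖ ^ 2)
    (hfs : ∀ x, fs ≤ f x) (x : E) (hσ0 : 0 < σ) (hσ : σ < √(lam / 2)) :
    ∃ y, f y = fs ∧ σ * ‖y - x‖ ≤ √(f x - fs) := by
  have hc : Continuous f := continuous_iff_continuousAt.2 fun x =>
    (hf x).hasFDerivAt.continuousAt
  obtain ⟨z, hmin⟩ := Continuous.exists_forall_le (f := fun y => √(f y - fs) + σ * ‖y - x‖)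
    (by fun_prop) (by
      refine Filter.tendsto_atTop_mono (f := fun y => σ * (‖y‖ - ‖x‖)) (fun y => ?_) ?_
      · have := norm_sub_norm_le y x
        have := mul_le_mul_of_nonneg_left this hσ0.le
        have := Real.sqrt_nonneg (f y - fs)
        linarith
      · exact (Filter.tendsto_atTop_add_const_right _ _
          (tendsto_norm_cocompact_atTop)).const_mul_atTop hσ0)
  refine ⟨z, ?_, ?_⟩
  · by_contra hne
    obtain ⟨w', hw', hn⟩ := exists_hasFDerivAt_sqrt_sub (hf z) (hPL z)
      (lt_of_le_of_ne (hfs z) (Ne.symm hne))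
    have := norm_le_of_le_add_norm_sub hσ0.le hw'.neg (by
      refine Filter.Eventually.of_forall fun y => ?_
      have h1 := hmin y
      have h2 := norm_sub_le_norm_sub_add_norm_sub y z x
      have h3 := mul_le_mul_of_nonneg_left h2 hσ0.le
      simp only [Pi.neg_apply]
      linarith)
    rw [norm_neg] at this
    linarith
  · have h1 := hmin x
    simp only [sub_self, norm_zero, mul_zero, add_zero] at h1
    have := Real.sqrt_nonneg (f z - fs)
    linarith

/-- If `f` is gradient dominated with constant `lam` and `f - (L / 2) ‖· - x‖²` is bounded by `a`,
then `f x - fs ≤ (1 - lam / L) (a - fs)`. -/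
theorem sub_le_of_forall_le_add_sq {f : E → ℝ} {G : E → E} {lam fs L a : ℝ}
    (hf : ∀ x, HasGradientAt f (G x) x) (hPL : ∀ x, 2 * lam * (f x - fs) ≤ ‖G x‖ ^ 2)
    (hfs : ∀ x, fs ≤ f x) (hlam : 0 < lam) (hL : 0 < L) (x : E)
    (ha : ∀ y, f y ≤ a + L / 2 * ‖y - x‖ ^ 2) :
    f x = fs ∨ (lam / L < 1 ∧ f x - fs ≤ (1 - lam / L) * (a - fs)) := by
  rcases (hfs x).eq_or_lt with h | h
  · exact Or.inl h.symm
  right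
  have h0 : 0 < f x - fs := sub_pos.2 h
  set w := √(f x - fs) with hw
  have hw0 : 0 < w := Real.sqrt_pos.2 h0
  have hw2 : w ^ 2 = f x - fs := Real.sq_sqrt h0.le
  have hsig : 0 < √(lam / 2) := Real.sqrt_pos.2 (by positivity)
  have hsig2 : √(lam / 2) ^ 2 = lam / 2 := Real.sq_sqrt (by positivity)
  have key : ∀ s : ℝ, 0 ≤ s → (w + √(lam / 2) * s) ^ 2 ≤ a - fs + L / 2 * s ^ 2 := by
    intro s hs
    -- The growth lemma needs σ strictly below √(lam/2); the endpoint is reached as a limit.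
    have hlim : Filter.Tendsto (fun σ => (w + σ * s) ^ 2) (nhdsWithin (√(lam / 2)) (Set.Iio √(lam / 2)))
        (nhds ((w + √(lam / 2) * s) ^ 2)) := by
      have : Continuous (fun σ : ℝ => (w + σ * s) ^ 2) := by fun_prop
      exact this.continuousAt.tendsto.mono_left nhdsWithin_le_nhds
    refine le_of_tendsto hlim ?_
    filter_upwards [Ioo_mem_nhdsLT hsig] with σ hσ
    obtain ⟨y, hy, hy2⟩ := exists_sqrt_sub_ge hf hPL x h hσ.1.le hσ.2 hs
    have h1 := ha y
    rw [hy] at h1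
    have h2 := pow_le_pow_left₀ (add_nonneg hw0.le (mul_nonneg hσ.1.le hs)) hy2 2
    rw [Real.sq_sqrt (sub_nonneg.2 (hfs y))] at h2
    linarith
  set σ := √(lam / 2)
  have key2 : ∀ s : ℝ, 0 ≤ s → (f x - fs) + 2 * w * σ * s ≤ a - fs + (L - lam) / 2 * s ^ 2 := by
    intro s hs
    have := key s hs
    have e : (w + σ * s) ^ 2 = w ^ 2 + 2 * w * σ * s + σ ^ 2 * s ^ 2 := by ring
    rw [e, hw2, hsig2] at this
    linarith
  have hlt : lam < L := by
    by_contra hcon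
    push Not at hcon
    have hws : 0 < 2 * w * σ := by positivity
    -- If lam ≥ L the quadratic term is not positive, while this s makes the linear term exceed a -
    -- fs.
    have h1 := key2 ((|a - fs| + 1) / (2 * w * σ)) (by positivity)
    rw [mul_div_cancel₀ _ hws.ne'] at h1
    have h2 : (L - lam) / 2 * ((|a - fs| + 1) / (2 * w * σ)) ^ 2 ≤ 0 :=
      mul_nonpos_of_nonpos_of_nonneg (by linarith) (sq_nonneg _)
    have := le_abs_self (a - fs)
    linarith
  refine ⟨(div_lt_one hL).2 hlt, ?_⟩
  have hd : 0 < L - lam := sub_pos.2 hlt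
  -- The s at which `key2` is sharpest.
  have h1 := key2 (2 * w * σ / (L - lam)) (by positivity)
  have e1 : (L - lam) / 2 * (2 * w * σ / (L - lam)) ^ 2 = lam * (f x - fs) / (L - lam) := by
    rw [div_pow, mul_pow, mul_pow, hw2, hsig2]; field_simp
  have e2 : 2 * w * σ * (2 * w * σ / (L - lam)) = 2 * (lam * (f x - fs) / (L - lam)) := by
    have : 2 * w * σ * (2 * w * σ / (L - lam)) = 4 * w ^ 2 * σ ^ 2 / (L - lam) := by ring
    rw [this, hw2, hsig2]; ring
  rw [e1, e2] at h1
  have h3 : (f x - fs) * (L / (L - lam)) ≤ a - fs := by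
    have : (f x - fs) * (L / (L - lam)) = (f x - fs) + lam * (f x - fs) / (L - lam) := by
      field_simp; ring
    linarith
  have h4 : 0 ≤ 1 - lam / L := by rw [sub_nonneg, div_le_one hL]; exact hlt.le
  have h5 := mul_le_mul_of_nonneg_left h3 h4
  have e3 : (1 - lam / L) * ((f x - fs) * (L / (L - lam))) = f x - fs := by field_simp
  linarith

end Calculus

/-! ### From contractions to the stated rate. -/

/-- The recursion behind the convergence rate. -/
theorem le_rate_of_contractions {Δ : ℕ → ℝ} {Lθ Lx lam S B h : ℝ} (hLθ : 0 < Lθ) (hLx : 0 < Lx)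
    (hlam : 0 < lam) (hS : 0 ≤ S) (hB : Lθ ^ 2 * S * Lx / 2 ≤ B) (hh : 0 ≤ h)
    (hnn : ∀ k, 0 ≤ Δ k)
    (hone : Δ 1 = 0 ∨ (lam / Lθ < 1 ∧ Δ 1 ≤ (1 - lam / Lθ) * Δ 0))
    (hstep : ∀ k, Δ (k + 2) = 0 ∨
      (lam / Lθ < 1 ∧ Δ (k + 2) ≤ (1 - lam / Lθ) * ((1 - lam / Lθ) * Δ (k + 1))))
    (hbound : ∀ k, Δ (k + 1) ≤ Lx * Lθ * S / lam) (k : ℕ) :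
    Δ k ≤ Real.exp (-(k * lam * (h + 1 / Lθ))) * Δ 0 +
      h ^ 2 * B / (1 - Real.exp (-(lam * (h + 1 / Lθ)))) := by
  have hB0 : 0 ≤ B := le_trans (by positivity) hB
  set r := lam / Lθ with hr
  have hr0 : 0 < r := by positivity
  set t := lam * (h + 1 / Lθ) with ht
  have htr : t = r + lam * h := by rw [ht, hr]; ring
  have ht0 : 0 < t := by rw [htr]; positivity
  set γ := Real.exp (-t) with hγ
  have hγ0 : 0 < γ := Real.exp_pos _
  have hγ1 : γ < 1 := by rw [hγ, Real.exp_lt_one_iff]; linarith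
  have hexp : Real.exp (-(k * lam * (h + 1 / Lθ))) = γ ^ k := by
    rw [hγ, ← Real.exp_nat_mul]; congr 1; rw [ht]; ring
  rw [hexp]
  set e := h ^ 2 * B / (1 - γ) with he
  have hγsub : 0 < 1 - γ := sub_pos.2 hγ1
  have he0 : 0 ≤ e := by positivity
  have heγ : e * (1 - γ) = h ^ 2 * B := by rw [he]; field_simp
  -- With only one factor 1 - r available, the first iteration may spend the whole geometric sum e =
  -- h²B/(1-γ). Since e = γe + h²B, e is a fixed point of the later recursion.
  have first : Δ 1 ≤ γ * Δ 0 + e := by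
    rcases hone with h0 | ⟨hr1, hd⟩
    · rw [h0]; have := mul_nonneg hγ0.le (hnn 0); linarith
    rcases le_or_gt (1 - r) γ with hge | hlt
    · have := mul_le_mul_of_nonneg_right hge (hnn 0); linarith
    have hc : 0 < 1 - r := by linarith
    have hb := hbound 0
    rw [zero_add] at hb
    have haux := one_sub_exp_mul_le_sq r t hr0 hr1 hlt.le
    rw [← hγ] at haux
    have h1 : (1 - r) * (Δ 1 - γ * Δ 0) ≤ Δ 1 * (1 - r - γ) := by
      have := mul_le_mul_of_nonneg_left hd hγ0.le
      linarith
    have h2 : Δ 1 * (1 - r - γ) ≤ Lx * Lθ * S / lam * (1 - r - γ) :=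
      mul_le_mul_of_nonneg_right hb (by linarith)
    have h3 : Lx * Lθ * S / lam * (1 - r - γ) * (1 - γ) ≤ (1 - r) * (h ^ 2 * B) := by
      have e1 : t - r = lam * h := by rw [htr]; ring
      rw [e1] at haux
      have h4 := mul_le_mul_of_nonneg_left haux
        (show 0 ≤ Lx * Lθ * S / lam / (2 * r) by positivity)
      have e2 : Lx * Lθ * S / lam / (2 * r) * (2 * r * (1 - γ) * (1 - r - γ)) =
          Lx * Lθ * S / lam * (1 - r - γ) * (1 - γ) := by field_simp
      have e3 : Lx * Lθ * S / lam / (2 * r) * ((1 - r) * (lam * h) ^ 2) =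
          (1 - r) * (h ^ 2 * (Lθ ^ 2 * S * Lx / 2)) := by
        have : Lx * Lθ * S / lam / (2 * r) = Lθ ^ 2 * S * Lx / 2 / lam ^ 2 := by
          rw [hr]; field_simp
        rw [this]; field_simp
      rw [e2, e3] at h4
      exact h4.trans (by gcongr)
    rw [← heγ, ← mul_assoc] at h3
    have h5 := le_of_mul_le_mul_right h3 hγsub
    have h6 : (1 - r) * (Δ 1 - γ * Δ 0) ≤ (1 - r) * e := h1.trans (h2.trans h5)
    have := le_of_mul_le_mul_left h6 hc
    linarith
  have step : ∀ k, Δ (k + 2) ≤ γ * Δ (k + 1) + h ^ 2 * B := by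
    intro k
    have hh2B : 0 ≤ h ^ 2 * B := by positivity
    rcases hstep k with h0 | ⟨hr1, hd⟩
    · rw [h0]; have := mul_nonneg hγ0.le (hnn (k + 1)); linarith
    have hc : 0 < 1 - r := by linarith
    have hle : 1 - r ≤ Real.exp (-r) := by have := Real.add_one_le_exp (-r); linarith
    have hd2 : Δ (k + 2) ≤ Real.exp (-(2 * r)) * Δ (k + 1) := by
      have e : Real.exp (-(2 * r)) = Real.exp (-r) * Real.exp (-r) := by
        rw [← Real.exp_add]; ring_nf
      rw [e, mul_assoc]
      refine hd.trans ?_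
      have := hnn (k + 1)
      gcongr
    -- Bounding e^{r - lam h} below by its tangent 1 + r - lam h leaves the excess (lam h -
    -- r)Δ(k+2), to be covered by h²B.
    have hfac : γ = Real.exp (r - lam * h) * Real.exp (-(2 * r)) := by
      rw [hγ, ← Real.exp_add, htr]; ring_nf
    have h1 : Real.exp (r - lam * h) * Δ (k + 2) ≤ γ * Δ (k + 1) := by
      rw [hfac, mul_assoc]; gcongr
    have h2 : 1 + (r - lam * h) ≤ Real.exp (r - lam * h) := by
      have := Real.add_one_le_exp (r - lam * h); linarith
    have h3 := mul_le_mul_of_nonneg_right h2 (hnn (k + 2))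
    have h4 : Δ (k + 2) * (lam * h - r) ≤ h ^ 2 * B := by
      rcases le_or_gt (lam * h) r with hle | hgt
      · exact (mul_nonpos_of_nonneg_of_nonpos (hnn _) (by linarith)).trans hh2B
      have h5 := mul_le_mul_of_nonneg_right (hbound (k + 1)) (show 0 ≤ lam * h - r by linarith)
      refine h5.trans ?_
      have e1 : Lx * Lθ * S / lam * (lam * h - r) = Lx * S * (Lθ * h - 1) := by
        rw [hr]; field_simp
      rw [e1]
      have h6 : h ^ 2 * (Lθ ^ 2 * S * Lx / 2) ≤ h ^ 2 * B := by gcongr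
      -- This is y - 1 ≤ y²/2 with y = Lθ h, scaled by 2 Lx S.
      have h7 : 0 ≤ Lx * S * ((Lθ * h - 1) ^ 2 + 1) := by positivity
      linarith
    linarith
  clear hexp
  rcases k with _ | k
  · simpa using he0
  induction k with
  | zero => simpa using first
  | succ k ih =>
    have h1 := step k
    have h2 := mul_le_mul_of_nonneg_left ih hγ0.le
    rw [pow_succ]
    linarith

/-! ### Integrability and smoothness of the expected log-likelihood. -/

section LogLikelihood

variable {m d : ℕ} {ρ : Euc m → Euc d → ℝ} {Lθ Lx : ℝ}

theorem GradLipschitz.gradParam_sub_le (hgrad : GradLipschitz ρ Lθ Lx) (θ θ' : Euc m)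
    (x x' : Euc d) :
    ‖gradParam ρ θ x - gradParam ρ θ' x'‖ ≤ Lθ * ‖θ - θ'‖ + Lx * ‖x - x'‖ :=
  (Real.le_sqrt_of_sq_le (le_add_of_nonneg_right (sq_nonneg _))).trans (hgrad.lipschitz θ θ' x x')

theorem GradLipschitz.gradLatent_sub_le (hgrad : GradLipschitz ρ Lθ Lx) (θ θ' : Euc m)
    (x x' : Euc d) :
    ‖gradLatent ρ θ x - gradLatent ρ θ' x'‖ ≤ Lθ * ‖θ - θ'‖ + Lx * ‖x - x'‖ :=
  (Real.le_sqrt_of_sq_le (le_add_of_nonneg_left (sq_nonneg _))).trans (hgrad.lipschitz θ θ' x x')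

theorem GradLipschitz.differentiable_param (hgrad : GradLipschitz ρ Lθ Lx) (x : Euc d) :
    Differentiable ℝ (fun ϑ => logLik ρ ϑ x) :=
  hgrad.differentiable.comp (differentiable_id.prodMk (differentiable_const x))

theorem GradLipschitz.differentiable_latent (hgrad : GradLipschitz ρ Lθ Lx) (θ : Euc m) :
    Differentiable ℝ (fun y => logLik ρ θ y) :=
  hgrad.differentiable.comp ((differentiable_const θ).prodMk differentiable_id)

theorem GradLipschitz.continuous_gradParam (hgrad : GradLipschitz ρ Lθ Lx) (θ : Euc m) :
    Continuous (gradParam ρ θ) := by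
  refine (LipschitzWith.of_dist_le_mul (K := Lx.toNNReal) fun x y => ?_).continuous
  rw [dist_eq_norm, dist_eq_norm]
  have := hgrad.gradParam_sub_le θ θ x y
  rw [sub_self, norm_zero, mul_zero, zero_add] at this
  exact this.trans (mul_le_mul_of_nonneg_right (Real.le_coe_toNNReal Lx) (norm_nonneg _))

theorem GradLipschitz.abs_logLik_param_le (hgrad : GradLipschitz ρ Lθ Lx) (θ v : Euc m)
    (x : Euc d) :
    |logLik ρ (θ + v) x - logLik ρ θ x - inner ℝ (gradParam ρ θ x) v| ≤ Lθ / 2 * ‖v‖ ^ 2 :=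
  abs_sub_sub_inner_le (hgrad.differentiable_param x)
    (fun ϑ ϑ' => by simpa [gradParam] using hgrad.gradParam_sub_le ϑ ϑ' x x) θ v

theorem GradLipschitz.abs_logLik_latent_le (hgrad : GradLipschitz ρ Lθ Lx) (θ : Euc m)
    (x v : Euc d) :
    |logLik ρ θ (x + v) - logLik ρ θ x - inner ℝ (gradLatent ρ θ x) v| ≤ Lx / 2 * ‖v‖ ^ 2 :=
  abs_sub_sub_inner_le (hgrad.differentiable_latent θ)
    (fun y y' => by simpa [gradLatent] using hgrad.gradLatent_sub_le θ θ y y') x v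

variable {q : Measure (Euc d)}

theorem IsP2.integrable_norm (hq : IsP2 q) : Integrable (fun x => ‖x‖) q := by
  have := hq.prob
  refine ((integrable_const (1 : ℝ)).add hq.second_moment).mono' (by fun_prop) ?_
  refine Filter.Eventually.of_forall fun x => ?_
  rw [norm_norm, Pi.add_apply]
  nlinarith [sq_nonneg (‖x‖ - 1)]

theorem IsP2.integrable_norm_sub_sq (hq : IsP2 q) (y : Euc d) :
    Integrable (fun x => ‖x - y‖ ^ 2) q := by
  have := hq.prob
  refine ((hq.second_moment.const_mul 2).add (integrable_const (2 * ‖y‖ ^ 2))).mono'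
    (by fun_prop) ?_
  refine Filter.Eventually.of_forall fun x => ?_
  rw [Real.norm_of_nonneg (by positivity), Pi.add_apply]
  have := pow_le_pow_left₀ (norm_nonneg _) (norm_sub_le x y) 2
  nlinarith [sq_nonneg (‖x‖ - ‖y‖)]

/-- A Lipschitz gradient gives at most quadratic growth in x, so the M-step objective is a genuine
finite integral for every q in `IsP2`. -/
theorem GradLipschitz.integrable_logLik (hgrad : GradLipschitz ρ Lθ Lx) (hq : IsP2 q)
    (θ : Euc m) : Integrable (logLik ρ θ) q := by
  have := hq.prob
  refine (((integrable_const |logLik ρ θ 0|).add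
    (hq.integrable_norm.const_mul ‖gradLatent ρ θ 0‖)).add
    (hq.second_moment.const_mul (Lx / 2))).mono'
    (hgrad.differentiable_latent θ).continuous.aestronglyMeasurable ?_
  refine Filter.Eventually.of_forall fun x => ?_
  have h1 := abs_le.1 (hgrad.abs_logLik_latent_le θ 0 x)
  have h2 := abs_le.1 (abs_real_inner_le_norm (gradLatent ρ θ 0) x)
  have h3 := neg_abs_le (logLik ρ θ 0)
  have h4 := le_abs_self (logLik ρ θ 0)
  rw [zero_add] at h1
  rw [Real.norm_eq_abs, Pi.add_apply, Pi.add_apply, abs_le]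
  constructor <;> linarith

theorem GradLipschitz.integrable_gradParam (hgrad : GradLipschitz ρ Lθ Lx) (hq : IsP2 q)
    (θ : Euc m) : Integrable (gradParam ρ θ) q := by
  have := hq.prob
  refine ((integrable_const ‖gradParam ρ θ 0‖).add (hq.integrable_norm.const_mul Lx)).mono'
    (hgrad.continuous_gradParam θ).aestronglyMeasurable ?_
  refine Filter.Eventually.of_forall fun x => ?_
  have h1 := hgrad.gradParam_sub_le θ θ x 0
  have h2 := norm_sub_norm_le (gradParam ρ θ x) (gradParam ρ θ 0)
  rw [sub_self, norm_zero, mul_zero, zero_add, sub_zero] at h1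
  rw [Pi.add_apply]
  linarith

/-- The expected log-likelihood is `Lθ`-smooth in the parameter. -/
theorem GradLipschitz.abs_integral_logLik_le (hgrad : GradLipschitz ρ Lθ Lx) (hq : IsP2 q)
    (θ v : Euc m) :
    |(∫ x, logLik ρ (θ + v) x ∂q) - (∫ x, logLik ρ θ x ∂q) -
      inner ℝ (∫ x, gradParam ρ θ x ∂q) v| ≤ Lθ / 2 * ‖v‖ ^ 2 := by
  have := hq.prob
  have h1 := hgrad.integrable_logLik hq θ
  have h2 := hgrad.integrable_logLik hq (θ + v)
  have h3 := hgrad.integrable_gradParam hq θ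
  have h4 : Integrable (fun x => inner ℝ (gradParam ρ θ x) v) q := h3.inner_const v
  have e : (∫ x, logLik ρ (θ + v) x ∂q) - (∫ x, logLik ρ θ x ∂q) -
      inner ℝ (∫ x, gradParam ρ θ x ∂q) v =
      ∫ x, (logLik ρ (θ + v) x - logLik ρ θ x - inner ℝ (gradParam ρ θ x) v) ∂q := by
    have h5 : Integrable (fun x => logLik ρ (θ + v) x - logLik ρ θ x) q := h2.sub h1
    rw [integral_sub h5 h4, integral_sub h2 h1, real_inner_comm, ← integral_inner h3]
    simp_rw [real_inner_comm v]
  rw [e, ← Real.norm_eq_abs]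
  have := norm_integral_le_of_norm_le_const (μ := q) (C := Lθ / 2 * ‖v‖ ^ 2)
    (f := fun x => logLik ρ (θ + v) x - logLik ρ θ x - inner ℝ (gradParam ρ θ x) v)
    (Filter.Eventually.of_forall fun x => hgrad.abs_logLik_param_le θ v x)
  simpa using this

/-- A gradient step of length 1/Lθ would raise the objective by at least ‖g‖²/(2Lθ); no
differentiation under the integral is required. -/
theorem GradLipschitz.integral_gradParam_eq_zero (hgrad : GradLipschitz ρ Lθ Lx) (hLθ : 0 < Lθ)
    (hq : IsP2 q) {θ : Euc m}
    (hmax : ∀ ϑ, ∫ x, logLik ρ ϑ x ∂q ≤ ∫ x, logLik ρ θ x ∂q) :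
    ∫ x, gradParam ρ θ x ∂q = 0 := by
  set g := ∫ x, gradParam ρ θ x ∂q with hg
  have h1 := (abs_le.1 (hgrad.abs_integral_logLik_le hq θ ((1 / Lθ) • g))).1
  have h2 := hmax (θ + (1 / Lθ) • g)
  rw [← hg, inner_smul_right, real_inner_self_eq_norm_sq, norm_smul,
    Real.norm_of_nonneg (by positivity)] at h1
  have e : Lθ / 2 * (1 / Lθ * ‖g‖) ^ 2 = 1 / Lθ * ‖g‖ ^ 2 / 2 := by field_simp
  rw [e] at h1
  have h3 : 1 / Lθ * ‖g‖ ^ 2 ≤ 0 := by linarith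
  have h4 : ‖g‖ ^ 2 ≤ 0 := nonpos_of_mul_nonpos_right h3 (by positivity)
  have h5 := pow_eq_zero_iff (two_ne_zero) |>.1 (le_antisymm h4 (sq_nonneg ‖g‖))
  exact norm_eq_zero.1 h5

/-- The decrease of the free energy in a maximisation step. -/
theorem GradLipschitz.sq_norm_integral_gradParam_le (hgrad : GradLipschitz ρ Lθ Lx) (hLθ : 0 < Lθ)
    (hq : IsP2 q) (θ : Euc m) {ϑ : Euc m}
    (hmax : ∀ ϑ', ∫ x, logLik ρ ϑ' x ∂q ≤ ∫ x, logLik ρ ϑ x ∂q) :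
    ‖∫ x, gradParam ρ θ x ∂q‖ ^ 2 / (2 * Lθ) ≤
      (∫ x, logLik ρ ϑ x ∂q) - ∫ x, logLik ρ θ x ∂q := by
  set g := ∫ x, gradParam ρ θ x ∂q with hg
  have h1 := (abs_le.1 (hgrad.abs_integral_logLik_le hq θ ((1 / Lθ) • g))).1
  have h2 := hmax (θ + (1 / Lθ) • g)
  rw [← hg, inner_smul_right, real_inner_self_eq_norm_sq, norm_smul,
    Real.norm_of_nonneg (by positivity)] at h1
  have e : Lθ / 2 * (1 / Lθ * ‖g‖) ^ 2 = ‖g‖ ^ 2 / (2 * Lθ) := by field_simp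
  have e2 : 1 / Lθ * ‖g‖ ^ 2 = 2 * (‖g‖ ^ 2 / (2 * Lθ)) := by field_simp
  rw [e, e2] at h1
  linarith

theorem GradLipschitz.norm_integral_gradParam_sub_le (hgrad : GradLipschitz ρ Lθ Lx)
    (hLx : 0 < Lx) (hq : IsP2 q) (θ : Euc m) (y : Euc d) :
    ‖(∫ x, gradParam ρ θ x ∂q) - gradParam ρ θ y‖ ≤ Lx * √(∫ x, ‖x - y‖ ^ 2 ∂q) := by
  have := hq.prob
  have h1 := hgrad.integrable_gradParam hq θ
  have hsq := hq.integrable_norm_sub_sq y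
  have e : (∫ x, gradParam ρ θ x ∂q) - gradParam ρ θ y =
      ∫ x, (gradParam ρ θ x - gradParam ρ θ y) ∂q := by
    rw [integral_sub h1 (integrable_const _)]; simp
  have hint : Integrable (fun x => ‖x - y‖) q := by
    refine ((integrable_const (1 : ℝ)).add hsq).mono' (by fun_prop) ?_
    refine Filter.Eventually.of_forall fun x => ?_
    rw [norm_norm, Pi.add_apply]
    nlinarith [sq_nonneg (‖x - y‖ - 1)]
  rw [e]
  calc _ ≤ ∫ x, Lx * ‖x - y‖ ∂q := by
        refine norm_integral_le_of_norm_le (hint.const_mul Lx) ?_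
        refine Filter.Eventually.of_forall fun x => ?_
        simpa using hgrad.gradParam_sub_le θ θ x y
    _ = Lx * ∫ x, ‖x - y‖ ∂q := integral_const_mul _ _
    _ ≤ _ := by
        refine mul_le_mul_of_nonneg_left (Real.le_sqrt_of_sq_le ?_) hLx.le
        set a := ∫ x, ‖x - y‖ ∂q with ha
        -- Nonnegativity of the variance gives (∫ ‖x - y‖)² ≤ ∫ ‖x - y‖².
        have h0 : 0 ≤ ∫ x, (‖x - y‖ - a) ^ 2 ∂q := integral_nonneg fun x => sq_nonneg _
        have e2 : ∀ x, (‖x - y‖ - a) ^ 2 = ‖x - y‖ ^ 2 - 2 * a * ‖x - y‖ + a ^ 2 := fun x => by ring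
        simp_rw [e2] at h0
        have h2 : Integrable (fun x => ‖x - y‖ ^ 2 - 2 * a * ‖x - y‖) q :=
          hsq.sub (hint.const_mul _)
        rw [integral_add h2 (integrable_const _),
          integral_sub hsq (hint.const_mul _), integral_const_mul, ← ha] at h0
        simp only [integral_const, probReal_univ, one_smul] at h0
        linarith

theorem GradLipschitz.norm_integral_gradParam_sub_integral_le (hgrad : GradLipschitz ρ Lθ Lx)
    (hq : IsP2 q) (θ θ' : Euc m) :
    ‖(∫ x, gradParam ρ θ x ∂q) - ∫ x, gradParam ρ θ' x ∂q‖ ≤ Lθ * ‖θ - θ'‖ := by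
  have := hq.prob
  rw [← integral_sub (hgrad.integrable_gradParam hq θ) (hgrad.integrable_gradParam hq θ')]
  have := norm_integral_le_of_norm_le_const (μ := q) (C := Lθ * ‖θ - θ'‖)
    (f := fun x => gradParam ρ θ x - gradParam ρ θ' x)
    (Filter.Eventually.of_forall fun x => by simpa using hgrad.gradParam_sub_le θ θ' x x)
  simpa using this

end LogLikelihood

/-! ### Free energy, Gibbs' inequality and the gradient of -log Z. -/

section FreeEnergy

variable {m d : ℕ} {ρ : Euc m → Euc d → ℝ} {Lθ Lx lam : ℝ} {q : Measure (Euc d)}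

theorem ModelRegular.marginal_pos (hmodel : ModelRegular ρ) (θ : Euc m) : 0 < marginal ρ θ := by
  refine (integral_pos_iff_support_of_nonneg (fun x => (hmodel.pos θ x).le)
    (hmodel.integrable θ)).2 ?_
  have : Function.support (ρ θ) = Set.univ := by
    ext x; simpa using (hmodel.pos θ x).ne'
  rw [this]
  exact isOpen_univ.measure_pos _ ⟨0, trivial⟩

theorem ModelRegular.posterior_pos (hmodel : ModelRegular ρ) (θ : Euc m) (x : Euc d) :
    0 < posterior ρ θ x := div_pos (hmodel.pos θ x) (hmodel.marginal_pos θ)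

theorem ModelRegular.measurable_posterior (hmodel : ModelRegular ρ) (θ : Euc m) :
    Measurable (posterior ρ θ) := (hmodel.posterior_contDiff θ).continuous.measurable

theorem ModelRegular.continuous_density (hmodel : ModelRegular ρ) (θ : Euc m) :
    Continuous (ρ θ) := by
  have : ρ θ = fun x => posterior ρ θ x * marginal ρ θ := by
    ext x; exact (div_mul_cancel₀ _ (hmodel.marginal_pos θ).ne').symm
  rw [this]
  exact (hmodel.posterior_contDiff θ).continuous.mul continuous_const

theorem ModelRegular.lintegral_posterior (hmodel : ModelRegular ρ) (θ : Euc m) :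
    ∫⁻ x, ENNReal.ofReal (posterior ρ θ x) = 1 := by
  have hi : Integrable (posterior ρ θ) := (hmodel.integrable θ).div_const _
  rw [← ofReal_integral_eq_lintegral_ofReal hi
    (Filter.Eventually.of_forall fun x => (hmodel.posterior_pos θ x).le)]
  have : ∫ x, posterior ρ θ x = 1 := by
    unfold posterior
    rw [integral_div]
    exact div_self (hmodel.marginal_pos θ).ne'
  rw [this, ENNReal.ofReal_one]

theorem ModelRegular.integral_posterior_smul (hmodel : ModelRegular ρ) (θ : Euc m)
    (g : Euc d → ℝ) :
    ∫ x, g x ∂(densityMeasure (posterior ρ θ)) = ∫ x, g x * posterior ρ θ x := by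
  unfold densityMeasure
  rw [integral_withDensity_eq_integral_toReal_smul
    (hmodel.measurable_posterior θ).ennreal_ofReal (by simp)]
  refine integral_congr_ae (Filter.Eventually.of_forall fun x => ?_)
  simp only [ENNReal.toReal_ofReal (hmodel.posterior_pos θ x).le, smul_eq_mul, mul_comm]

theorem ModelRegular.isP2_posterior (hmodel : ModelRegular ρ) (θ : Euc m) :
    IsP2 (densityMeasure (posterior ρ θ)) where
  prob := ⟨by
    unfold densityMeasure
    rw [withDensity_apply _ MeasurableSet.univ, Measure.restrict_univ,
      hmodel.lintegral_posterior θ]⟩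
  ac := withDensity_absolutelyContinuous _ _
  second_moment := by
    unfold densityMeasure
    rw [integrable_withDensity_iff_integrable_smul'
      (hmodel.measurable_posterior θ).ennreal_ofReal (by simp)]
    refine (hmodel.second_moment θ).congr (Filter.Eventually.of_forall fun x => ?_)
    simp only [ENNReal.toReal_ofReal (hmodel.posterior_pos θ x).le, smul_eq_mul, mul_comm]

theorem ModelRegular.isP21Density_posterior (hmodel : ModelRegular ρ) (θ : Euc m) :
    IsP21Density (posterior ρ θ) where
  nonneg x := (hmodel.posterior_pos θ x).le
  locallyLipschitz := ((hmodel.posterior_contDiff θ).of_le (by norm_num)).locallyLipschitz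
  isP2 := hmodel.isP2_posterior θ

/-- The logarithm of the Lebesgue density of a measure. -/
noncomputable def logDensity (q : Measure (Euc d)) (x : Euc d) : ℝ :=
  Real.log (q.rnDeriv volume x).toReal

theorem IsP2.rnDeriv_toReal_pos (hq : IsP2 q) : ∀ᵐ x ∂q, 0 < (q.rnDeriv volume x).toReal := by
  have := hq.prob
  filter_upwards [Measure.rnDeriv_pos hq.ac, hq.ac.ae_le (Measure.rnDeriv_ne_top q volume)]
    with x h1 h2
  exact ENNReal.toReal_pos h1.ne' h2

theorem ModelRegular.log_div_ae_eq (hmodel : ModelRegular ρ) (hq : IsP2 q) (θ : Euc m) :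
    (fun x => Real.log ((q.rnDeriv volume x).toReal / ρ θ x)) =ᵐ[q]
      fun x => logDensity q x - logLik ρ θ x := by
  filter_upwards [hq.rnDeriv_toReal_pos] with x hx
  exact Real.log_div hx.ne' (hmodel.pos θ x).ne'

theorem ModelRegular.absolutelyContinuous_densityMeasure (hmodel : ModelRegular ρ) (hq : IsP2 q)
    (θ : Euc m) : q ≪ densityMeasure (ρ θ) := by
  refine hq.ac.trans (withDensity_absolutelyContinuous' ?_ ?_)
  · exact (hmodel.continuous_density θ).measurable.ennreal_ofReal.aemeasurable
  · exact Filter.Eventually.of_forall fun x => by simpa using hmodel.pos θ x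

/-- Since ℓ is q-integrable, finiteness of the free energy depends on the entropy of q alone, and
not on θ. -/
theorem freeEnergy_eq_coe (hmodel : ModelRegular ρ) (hgrad : GradLipschitz ρ Lθ Lx) (hq : IsP2 q)
    (hlog : Integrable (logDensity q) q) (θ : Euc m) :
    freeEnergy ρ θ q = ((∫ x, logDensity q x ∂q) - ∫ x, logLik ρ θ x ∂q : ℝ) := by
  have hae := hmodel.log_div_ae_eq hq θ
  have hi := hgrad.integrable_logLik hq θ
  rw [freeEnergy, if_pos ⟨hmodel.absolutelyContinuous_densityMeasure hq θ,
    (integrable_congr hae).2 (hlog.sub hi)⟩, integral_congr_ae hae, integral_sub hlog hi]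

theorem freeEnergy_eq_top (hmodel : ModelRegular ρ) (hgrad : GradLipschitz ρ Lθ Lx) (hq : IsP2 q)
    (hlog : ¬ Integrable (logDensity q) q) (θ : Euc m) :
    freeEnergy ρ θ q = ⊤ := by
  have hae := hmodel.log_div_ae_eq hq θ
  have hi := hgrad.integrable_logLik hq θ
  refine if_neg fun h => hlog ?_
  have := ((integrable_congr hae).1 h.2).add hi
  refine this.congr (Filter.Eventually.of_forall fun x => ?_)
  simp

/-- Gibbs' variational inequality: the posterior minimises the free energy. -/
theorem neg_log_marginal_le (hmodel : ModelRegular ρ) (hgrad : GradLipschitz ρ Lθ Lx)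
    (hq : IsP2 q) (hlog : Integrable (logDensity q) q) (θ : Euc m) :
    -Real.log (marginal ρ θ) ≤ (∫ x, logDensity q x ∂q) - ∫ x, logLik ρ θ x ∂q := by
  have := hq.prob
  have hZ := hmodel.marginal_pos θ
  set u : Euc d → ℝ := fun x => posterior ρ θ x / (q.rnDeriv volume x).toReal with hu
  have humeas : Measurable u :=
    (hmodel.measurable_posterior θ).div (Measure.measurable_rnDeriv q volume).ennreal_toReal
  have hu0 : ∀ x, 0 ≤ u x := fun x =>
    div_nonneg (hmodel.posterior_pos θ x).le ENNReal.toReal_nonneg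
  -- Only an inequality: u = 0 where the density of q vanishes, so the posterior mass there is lost.
  -- The conclusion then follows from log u ≤ u - 1.
  have hlint : ∫⁻ x, ENNReal.ofReal (u x) ∂q ≤ 1 := by
    rw [← lintegral_rnDeriv_mul hq.ac humeas.ennreal_ofReal.aemeasurable,
      ← hmodel.lintegral_posterior θ]
    refine lintegral_mono_ae ?_
    filter_upwards [Measure.rnDeriv_ne_top q volume] with x hx
    rw [← ENNReal.ofReal_toReal hx, ← ENNReal.ofReal_mul ENNReal.toReal_nonneg]
    refine ENNReal.ofReal_le_ofReal ?_
    simp only [hu]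
    rcases (ENNReal.toReal_nonneg (a := q.rnDeriv volume x)).eq_or_lt with h0 | h0
    · rw [← h0, zero_mul]; exact (hmodel.posterior_pos θ x).le
    · exact (mul_div_cancel₀ _ h0.ne').le
  have huint : Integrable u q := by
    refine ⟨humeas.aestronglyMeasurable, ?_⟩
    rw [hasFiniteIntegral_iff_ofReal (Filter.Eventually.of_forall hu0)]
    exact hlint.trans_lt ENNReal.one_lt_top
  have hu1 : ∫ x, u x ∂q ≤ 1 := by
    rw [integral_eq_lintegral_of_nonneg_ae (Filter.Eventually.of_forall hu0)
      humeas.aestronglyMeasurable]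
    exact ENNReal.toReal_le_of_le_ofReal zero_le_one (by simpa using hlint)
  have hi := hgrad.integrable_logLik hq θ
  have hle : ∫ x, (1 - u x - Real.log (marginal ρ θ)) ∂q ≤
      ∫ x, (logDensity q x - logLik ρ θ x) ∂q := by
    refine integral_mono_ae (((integrable_const _).sub huint).sub (integrable_const _))
      (hlog.sub hi) ?_
    filter_upwards [hq.rnDeriv_toReal_pos] with x hx
    have h1 := Real.log_le_sub_one_of_pos (div_pos (hmodel.posterior_pos θ x) hx)
    rw [Real.log_div (hmodel.posterior_pos θ x).ne' hx.ne', posterior,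
      Real.log_div (hmodel.pos θ x).ne' hZ.ne'] at h1
    simp only [hu, logDensity, logLik, posterior]
    linarith
  have hint : Integrable (fun x => 1 - u x) q := (integrable_const _).sub huint
  rw [integral_sub hlog hi, integral_sub hint (integrable_const _),
    integral_sub (integrable_const _) huint] at hle
  simp only [integral_const, probReal_univ, one_smul] at hle
  linarith

theorem logDensity_posterior_ae_eq (hmodel : ModelRegular ρ) (θ : Euc m) :
    logDensity (densityMeasure (posterior ρ θ)) =ᵐ[densityMeasure (posterior ρ θ)]
      fun x => logLik ρ θ x - Real.log (marginal ρ θ) := by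
  have h := Measure.rnDeriv_withDensity (volume : Measure (Euc d))
    (hmodel.measurable_posterior θ).ennreal_ofReal
  filter_upwards [(withDensity_absolutelyContinuous volume _).ae_le h] with x hx
  have hx' : (densityMeasure (posterior ρ θ)).rnDeriv volume x =
    ENNReal.ofReal (posterior ρ θ x) := hx
  rw [logDensity, hx', ENNReal.toReal_ofReal (hmodel.posterior_pos θ x).le, posterior,
    Real.log_div (hmodel.pos θ x).ne' (hmodel.marginal_pos θ).ne', logLik]

theorem integrable_logDensity_posterior (hmodel : ModelRegular ρ) (hgrad : GradLipschitz ρ Lθ Lx)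
    (θ : Euc m) : Integrable (logDensity (densityMeasure (posterior ρ θ)))
      (densityMeasure (posterior ρ θ)) := by
  have hq := hmodel.isP2_posterior θ
  have := hq.prob
  exact (integrable_congr (logDensity_posterior_ae_eq hmodel θ)).2
    ((hgrad.integrable_logLik hq θ).sub (integrable_const _))

theorem integral_logDensity_posterior (hmodel : ModelRegular ρ) (hgrad : GradLipschitz ρ Lθ Lx)
    (θ : Euc m) : ∫ x, logDensity (densityMeasure (posterior ρ θ)) x
      ∂(densityMeasure (posterior ρ θ)) =
      (∫ x, logLik ρ θ x ∂(densityMeasure (posterior ρ θ))) - Real.log (marginal ρ θ) := by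
  have hq := hmodel.isP2_posterior θ
  have := hq.prob
  rw [integral_congr_ae (logDensity_posterior_ae_eq hmodel θ),
    integral_sub (hgrad.integrable_logLik hq θ) (integrable_const _)]
  simp

theorem freeEnergy_posterior (hmodel : ModelRegular ρ) (hgrad : GradLipschitz ρ Lθ Lx)
    (θ : Euc m) : freeEnergy ρ θ (densityMeasure (posterior ρ θ)) =
      (-Real.log (marginal ρ θ) : ℝ) := by
  rw [freeEnergy_eq_coe hmodel hgrad (hmodel.isP2_posterior θ)
    (integrable_logDensity_posterior hmodel hgrad θ), integral_logDensity_posterior hmodel hgrad]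
  congr 1; ring

theorem freeEnergyInf_le (hq : IsP2 q) (θ : Euc m) : freeEnergyInf ρ ≤ freeEnergy ρ θ q :=
  iInf_le_of_le θ (iInf_le_of_le q (iInf_le_of_le hq le_rfl))

/-- The ratio π_θ/ρ_θ is constant in x, so the latent term of the Fisher information vanishes. -/
theorem extFisher_posterior (hmodel : ModelRegular ρ) (θ : Euc m) :
    extFisher ρ θ (posterior ρ θ) =
      ENNReal.ofReal (‖∫ x, gradParam ρ θ x ∂(densityMeasure (posterior ρ θ))‖ ^ 2) := by
  have h : (fun y => Real.log (posterior ρ θ y / ρ θ y)) =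
      fun _ => Real.log (1 / marginal ρ θ) := by
    ext y
    rw [posterior, div_div, mul_comm, ← div_div, div_self (hmodel.pos θ y).ne']
  have h2 : ∀ x : Euc d, gradient (fun y => Real.log (posterior ρ θ y / ρ θ y)) x = 0 := by
    intro x; rw [h]; exact gradient_fun_const _ _
  unfold extFisher
  simp_rw [h2]
  simp

theorem exists_freeEnergyInf_eq (hmodel : ModelRegular ρ) (hgrad : GradLipschitz ρ Lθ Lx)
    (hlam : 0 < lam) (hxlsi : XLSI ρ lam) :
    ∃ fs : ℝ, freeEnergyInf ρ = fs ∧ (∀ θ, fs ≤ -Real.log (marginal ρ θ)) ∧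
      ∀ θ, 2 * lam * (-Real.log (marginal ρ θ) - fs) ≤
        ‖∫ x, gradParam ρ θ x ∂(densityMeasure (posterior ρ θ))‖ ^ 2 := by
  have hle : ∀ θ, freeEnergyInf ρ ≤ (-Real.log (marginal ρ θ) : ℝ) := fun θ => by
    rw [← freeEnergy_posterior hmodel hgrad θ]
    exact freeEnergyInf_le (hmodel.isP2_posterior θ) θ
  have hx : ∀ θ, ((2 * lam : ℝ) : EReal) * (((-Real.log (marginal ρ θ) : ℝ) : EReal) -
      freeEnergyInf ρ) ≤
      ((‖∫ x, gradParam ρ θ x ∂(densityMeasure (posterior ρ θ))‖ ^ 2 : ℝ) : EReal) := fun θ => by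
    have := hxlsi θ _ (hmodel.isP21Density_posterior θ)
    rwa [freeEnergy_posterior hmodel hgrad, extFisher_posterior hmodel,
      EReal.coe_ennreal_ofReal, max_eq_left (sq_nonneg _)] at this
  -- An infimum of -∞ would make the left side of the xLSI infinite at a posterior, whose Fisher
  -- information is finite.
  have hbot : freeEnergyInf ρ ≠ ⊥ := by
    intro h
    have := hx 0
    rw [h, EReal.coe_sub_bot, EReal.coe_mul_top_of_pos (by positivity)] at this
    exact absurd this (not_le.2 (EReal.coe_lt_top _))
  have htop : freeEnergyInf ρ ≠ ⊤ := ne_top_of_le_ne_top (EReal.coe_ne_top _) (hle 0)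
  refine ⟨(freeEnergyInf ρ).toReal, (EReal.coe_toReal htop hbot).symm, fun θ => ?_, fun θ => ?_⟩
  · have := hle θ
    rwa [← EReal.coe_toReal htop hbot, EReal.coe_le_coe_iff] at this
  · have := hx θ
    rwa [← EReal.coe_toReal htop hbot, ← EReal.coe_sub, ← EReal.coe_mul,
      EReal.coe_le_coe_iff] at this

/-- The gradient of `θ ↦ -log Z_θ`. -/
theorem hasGradientAt_neg_log_marginal (hmodel : ModelRegular ρ) (hgrad : GradLipschitz ρ Lθ Lx)
    (θ : Euc m) : HasGradientAt (fun ϑ => -Real.log (marginal ρ ϑ))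
      (-∫ x, gradParam ρ θ x ∂(densityMeasure (posterior ρ θ))) θ := by
  have hq := hmodel.isP2_posterior θ
  set q := densityMeasure (posterior ρ θ) with hqd
  set g := ∫ x, gradParam ρ θ x ∂q with hg
  set f : Euc m → ℝ := fun ϑ => -Real.log (marginal ρ ϑ) with hf
  have hdiff : HasFDerivAt f (fderiv ℝ f θ) θ :=
    (((hmodel.marginal_differentiable θ).log (hmodel.marginal_pos θ).ne').neg).hasFDerivAt
  -- Freezing q = π_θ in Gibbs' inequality gives a smooth upper bound that touches f at θ. As f is
  -- differentiable there, its gradient is that of the bound.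
  have hle : ∀ ϑ, f ϑ ≤ f θ - inner ℝ g (ϑ - θ) + Lθ / 2 * ‖ϑ - θ‖ ^ 2 := by
    intro ϑ
    have h1 := neg_log_marginal_le hmodel hgrad hq
      (integrable_logDensity_posterior hmodel hgrad θ) ϑ
    rw [integral_logDensity_posterior hmodel hgrad θ] at h1
    have h2 := (abs_le.1 (hgrad.abs_integral_logLik_le hq θ (ϑ - θ))).1
    rw [add_sub_cancel] at h2
    simp only [hf]
    linarith
  have hsq : HasFDerivAt (fun ϑ : Euc m => Lθ / 2 * ‖ϑ - θ‖ ^ 2) (0 : Euc m →L[ℝ] ℝ) θ := by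
    have := (((hasFDerivAt_id (𝕜 := ℝ) θ).sub_const θ).norm_sq).const_mul (Lθ / 2)
    simpa using this
  have hin : HasFDerivAt (fun ϑ : Euc m => inner ℝ g (ϑ - θ)) (innerSL ℝ g) θ :=
    (innerSL ℝ g).hasFDerivAt.comp θ ((hasFDerivAt_id (𝕜 := ℝ) θ).sub_const θ)
  have htot := (hdiff.add hin).sub hsq
  have hmax : IsLocalMax ((f + fun ϑ => inner ℝ g (ϑ - θ)) - fun ϑ => Lθ / 2 * ‖ϑ - θ‖ ^ 2) θ := by
    refine Filter.Eventually.of_forall fun ϑ => ?_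
    have := hle ϑ
    simp only [Pi.sub_apply, Pi.add_apply, sub_self, inner_zero_right, norm_zero]
    linarith
  have h0 := hmax.hasFDerivAt_eq_zero htot
  rw [sub_zero] at h0
  rw [hasGradientAt_iff_hasFDerivAt, map_neg]
  have h1 : fderiv ℝ f θ = -(InnerProductSpace.toDual ℝ (Euc m)) g := by
    rw [← add_eq_zero_iff_eq_neg]
    exact h0
  rw [← h1]
  exact hdiff

end FreeEnergy

/-! ### Contraction and boundedness of the EM iterates. -/

section EM

variable {m d : ℕ} {ρ : Euc m → Euc d → ℝ} {Lθ Lx lam fs : ℝ} {q : Measure (Euc d)}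

theorem IsEMSequence.isP2 {θ : ℕ → Euc m} {q : ℕ → Measure (Euc d)} (hEM : IsEMSequence ρ θ q)
    (hmodel : ModelRegular ρ) (k : ℕ) : IsP2 (q k) := by
  rcases k with _ | k
  · exact hEM.init
  · rw [hEM.eStep k]; exact hmodel.isP2_posterior _

/-- After a maximisation step, passing to the posterior contracts the free energy. -/
theorem neg_log_marginal_sub_le (hmodel : ModelRegular ρ) (hgrad : GradLipschitz ρ Lθ Lx)
    (hLθ : 0 < Lθ) (hlam : 0 < lam) (hfs : ∀ θ, fs ≤ -Real.log (marginal ρ θ))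
    (hPL : ∀ θ, 2 * lam * (-Real.log (marginal ρ θ) - fs) ≤
        ‖∫ x, gradParam ρ θ x ∂(densityMeasure (posterior ρ θ))‖ ^ 2)
    (hq : IsP2 q) (hlog : Integrable (logDensity q) q) {θ : Euc m}
    (hmax : ∀ ϑ, ∫ x, logLik ρ ϑ x ∂q ≤ ∫ x, logLik ρ θ x ∂q) :
    -Real.log (marginal ρ θ) = fs ∨ (lam / Lθ < 1 ∧ -Real.log (marginal ρ θ) - fs ≤
      (1 - lam / Lθ) * ((∫ x, logDensity q x ∂q) - (∫ x, logLik ρ θ x ∂q) - fs)) := by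
  refine sub_le_of_forall_le_add_sq (hasGradientAt_neg_log_marginal hmodel hgrad)
    (fun θ => by rw [norm_neg]; exact hPL θ) hfs hlam hLθ θ fun ϑ => ?_
  -- Gibbs at ϑ bounds f(ϑ) by F(ϑ, q), and F(·, q) lies below a parabola with vertex at its
  -- minimiser θ.
  have h1 := neg_log_marginal_le hmodel hgrad hq hlog ϑ
  have h2 := (abs_le.1 (hgrad.abs_integral_logLik_le hq θ (ϑ - θ))).1
  rw [add_sub_cancel, hgrad.integral_gradParam_eq_zero hLθ hq hmax, inner_zero_left] at h2
  linarith

/-- One iteration of the EM algorithm started from a posterior. -/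
theorem neg_log_marginal_sub_le_of_posterior (hmodel : ModelRegular ρ)
    (hgrad : GradLipschitz ρ Lθ Lx)
    (hLθ : 0 < Lθ) (hlam : 0 < lam) (hfs : ∀ θ, fs ≤ -Real.log (marginal ρ θ))
    (hPL : ∀ θ, 2 * lam * (-Real.log (marginal ρ θ) - fs) ≤
        ‖∫ x, gradParam ρ θ x ∂(densityMeasure (posterior ρ θ))‖ ^ 2) {θ θ' : Euc m}
    (hmax : ∀ ϑ, ∫ x, logLik ρ ϑ x ∂(densityMeasure (posterior ρ θ)) ≤
      ∫ x, logLik ρ θ' x ∂(densityMeasure (posterior ρ θ))) :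
    -Real.log (marginal ρ θ') = fs ∨ (lam / Lθ < 1 ∧ -Real.log (marginal ρ θ') - fs ≤
      (1 - lam / Lθ) * ((1 - lam / Lθ) * (-Real.log (marginal ρ θ) - fs))) := by
  have hq := hmodel.isP2_posterior θ
  rcases neg_log_marginal_sub_le hmodel hgrad hLθ hlam hfs hPL hq
    (integrable_logDensity_posterior hmodel hgrad θ) hmax with h | ⟨h1, h2⟩
  · exact Or.inl h
  refine Or.inr ⟨h1, h2.trans (mul_le_mul_of_nonneg_left ?_ (by linarith))⟩
  rw [integral_logDensity_posterior hmodel hgrad]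
  have h3 := hgrad.sq_norm_integral_gradParam_le hLθ hq θ hmax
  have h4 := div_le_div_of_nonneg_right (hPL θ) (show 0 ≤ 2 * Lθ by positivity)
  have e : 2 * lam * (-Real.log (marginal ρ θ) - fs) / (2 * Lθ) =
      lam / Lθ * (-Real.log (marginal ρ θ) - fs) := by field_simp
  rw [e] at h4
  linarith

/-- Every point of a sublevel set lies within √(c - fs)/σ of some minimiser of -log Z, and the
minimisers form a compact set. -/
theorem exists_forall_norm_le_of_le (hmodel : ModelRegular ρ) (hgrad : GradLipschitz ρ Lθ Lx)
    (hlam : 0 < lam) (hfs : ∀ θ, fs ≤ -Real.log (marginal ρ θ))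
    (hPL : ∀ θ, 2 * lam * (-Real.log (marginal ρ θ) - fs) ≤
        ‖∫ x, gradParam ρ θ x ∂(densityMeasure (posterior ρ θ))‖ ^ 2) (c : ℝ) :
    ∃ R, ∀ θ, -Real.log (marginal ρ θ) ≤ c → ‖θ‖ ≤ R := by
  obtain ⟨R, hR⟩ := hmodel.optimal_compact.isBounded.exists_norm_le
  have hsig : 0 < √(lam / 2) := Real.sqrt_pos.2 (by positivity)
  set σ := √(lam / 2) / 2 with hσ
  have hσ0 : 0 < σ := by positivity
  refine ⟨R + √(c - fs) / σ, fun θ hθ => ?_⟩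
  obtain ⟨y, hy, hy2⟩ := exists_eq_of_gradient_dominated
    (hasGradientAt_neg_log_marginal hmodel hgrad)
    (fun θ => by rw [norm_neg]; exact hPL θ) hfs θ hσ0 (half_lt_self hsig)
  have hyR := hR y fun ϑ => by
    have h1 := hfs ϑ
    rw [← hy] at h1
    exact (Real.log_le_log_iff (hmodel.marginal_pos _) (hmodel.marginal_pos _)).1
      (neg_le_neg_iff.1 h1)
  have h1 : ‖y - θ‖ ≤ √(c - fs) / σ := by
    rw [le_div_iff₀ hσ0, mul_comm]
    exact hy2.trans (Real.sqrt_le_sqrt (by linarith))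
  have h2 := norm_sub_norm_le θ y
  rw [norm_sub_rev] at h2
  linarith

theorem bddAbove_iterateSpread (hmodel : ModelRegular ρ) (hgrad : GradLipschitz ρ Lθ Lx)
    (hlam : 0 < lam) (hfs : ∀ θ, fs ≤ -Real.log (marginal ρ θ))
    (hPL : ∀ θ, 2 * lam * (-Real.log (marginal ρ θ) - fs) ≤
        ‖∫ x, gradParam ρ θ x ∂(densityMeasure (posterior ρ θ))‖ ^ 2)
    {θ : ℕ → Euc m} {q : ℕ → Measure (Euc d)} (hEM : IsEMSequence ρ θ q) {c : ℝ}
    (hc : ∀ k, -Real.log (marginal ρ (θ (k + 1))) ≤ c) (θd : Euc m) (xd : Euc d) :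
    BddAbove (Set.range (iterateSpread θ q θd xd)) := by
  obtain ⟨R, hR⟩ := exists_forall_norm_le_of_le hmodel hgrad hlam hfs hPL c
  obtain ⟨M, hM⟩ := (isCompact_closedBall (0 : Euc m) R).bddAbove_image
    hmodel.second_moment_continuous.continuousOn
  -- Index 0 is bounded separately because q_0 need not be a posterior.
  refine ⟨max (iterateSpread θ q θd xd 0) (2 * M + 2 * ‖xd‖ ^ 2 + (R + ‖θd‖) ^ 2), ?_⟩
  rintro _ ⟨k, rfl⟩
  rcases k with _ | k
  · exact le_max_left _ _
  refine le_max_of_le_right (add_le_add ?_ ?_)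
  · have hq := hEM.isP2 hmodel (k + 1)
    have := hq.prob
    have h1 : ∫ x, ‖x‖ ^ 2 ∂(q (k + 1)) ≤ M := by
      rw [hEM.eStep k, hmodel.integral_posterior_smul]
      exact hM ⟨θ (k + 1), by simpa using hR _ (hc k), rfl⟩
    have h2 : ∫ x, ‖x - xd‖ ^ 2 ∂(q (k + 1)) ≤
        ∫ x, (2 * ‖x‖ ^ 2 + 2 * ‖xd‖ ^ 2) ∂(q (k + 1)) := by
      refine integral_mono (hq.integrable_norm_sub_sq xd)
        ((hq.second_moment.const_mul 2).add (integrable_const _)) fun x => ?_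
      have := pow_le_pow_left₀ (norm_nonneg _) (norm_sub_le x xd) 2
      have := sq_nonneg (‖x‖ - ‖xd‖)
      dsimp only
      linarith
    rw [integral_add (hq.second_moment.const_mul 2) (integrable_const _), integral_const_mul] at h2
    simp only [integral_const, probReal_univ, one_smul] at h2
    linarith
  · refine pow_le_pow_left₀ (norm_nonneg _) ((norm_sub_le _ _).trans ?_) 2
    have := hR _ (hc (k + 1))
    linarith

/-- The expected gradient at (θ_{k+1}, q_{k+1}) vanishes if q_{k+1} is replaced by q_k, and also if
θ_{k+1} is replaced by θ_{k+2}. These two M-step conditions bound its norm through Lx and through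
Lθ; multiplying the bounds produces the product Lx Lθ. -/
theorem sq_norm_integral_gradParam_le_of_spread (hmodel : ModelRegular ρ)
    (hgrad : GradLipschitz ρ Lθ Lx) (hLθ : 0 < Lθ) (hLx : 0 < Lx)
    {θ : ℕ → Euc m} {q : ℕ → Measure (Euc d)} (hEM : IsEMSequence ρ θ q)
    {θd : Euc m} {xd : Euc d} {S : ℝ} (hS : ∀ k, iterateSpread θ q θd xd k ≤ S) (k : ℕ) :
    ‖∫ x, gradParam ρ (θ (k + 1)) x ∂(q (k + 1))‖ ^ 2 ≤ 2 * Lx * Lθ * S := by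
  have hq := hEM.isP2 hmodel k
  have hq' := hEM.isP2 hmodel (k + 1)
  have h0 := hgrad.integral_gradParam_eq_zero hLθ hq (hEM.mStep k)
  have h0' := hgrad.integral_gradParam_eq_zero hLθ hq' (hEM.mStep (k + 1))
  have h1 := hgrad.norm_integral_gradParam_sub_le hLx hq (θ (k + 1)) xd
  have h1' := hgrad.norm_integral_gradParam_sub_le hLx hq' (θ (k + 1)) xd
  have h2 := hgrad.norm_integral_gradParam_sub_integral_le hq' (θ (k + 1)) (θ (k + 2))
  rw [h0', sub_zero] at h2
  rw [h0, zero_sub, norm_neg] at h1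
  set g := ∫ x, gradParam ρ (θ (k + 1)) x ∂(q (k + 1)) with hg
  set s := ∫ x, ‖x - xd‖ ^ 2 ∂(q k) with hs
  set s' := ∫ x, ‖x - xd‖ ^ 2 ∂(q (k + 1)) with hs'
  have hs0 : 0 ≤ s := integral_nonneg fun x => sq_nonneg _
  have hs0' : 0 ≤ s' := integral_nonneg fun x => sq_nonneg _
  have hX : ‖g‖ ≤ Lx * (√s + √s') := by
    have := norm_le_norm_sub_add g (gradParam ρ (θ (k + 1)) xd)
    linarith
  have hY : ‖g‖ ≤ Lθ * (‖θ (k + 1) - θd‖ + ‖θ (k + 2) - θd‖) := by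
    refine h2.trans (mul_le_mul_of_nonneg_left ?_ hLθ.le)
    have := norm_sub_le (θ (k + 1) - θd) (θ (k + 2) - θd)
    rwa [sub_sub_sub_cancel_right] at this
  have hk : s + ‖θ (k + 1) - θd‖ ^ 2 ≤ S := hS k
  have hk' : s' + ‖θ (k + 2) - θd‖ ^ 2 ≤ S := hS (k + 1)
  set a := ‖θ (k + 1) - θd‖
  set b := ‖θ (k + 2) - θd‖
  -- AM-GM: the product is at most s + s' + a² + b², the sum of two consecutive spreads.
  have hXY : (√s + √s') * (a + b) ≤ 2 * S := by
    have e1 := Real.sq_sqrt hs0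
    have e2 := Real.sq_sqrt hs0'
    linarith [sq_nonneg (√s + √s' - (a + b)), sq_nonneg (√s - √s'), sq_nonneg (a - b)]
  calc ‖g‖ ^ 2 = ‖g‖ * ‖g‖ := sq _
    _ ≤ (Lx * (√s + √s')) * (Lθ * (a + b)) :=
        mul_le_mul hX hY (norm_nonneg _) (by positivity)
    _ = Lx * Lθ * ((√s + √s') * (a + b)) := by ring
    _ ≤ Lx * Lθ * (2 * S) := by gcongr
    _ = _ := by ring

end EM

/-! ### Assembly of the theorem. -/

theorem mainTheorem2 {m d : ℕ} (ρ : Euc m → Euc d → ℝ) (Lθ Lx lam : ℝ)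
    (hLθ : 0 < Lθ) (hLx : 0 < Lx) (hlam : 0 < lam)
    (hmodel : ModelRegular ρ) (hgrad : GradLipschitz ρ Lθ Lx) (hxlsi : XLSI ρ lam)
    (θd : Euc m) (xd : Euc d) (hstat : IsStationaryPoint ρ θd xd)
    (θ : ℕ → Euc m) (q : ℕ → Measure (Euc d)) (hEM : IsEMSequence ρ θ q) :
    BddAbove (Set.range (iterateSpread θ q θd xd)) ∧
    ∀ k : ℕ, freeEnergy ρ (θ k) (q k) - freeEnergyInf ρ ≤
      ⨅ (h : ℝ) (_ : h ∈ Set.Icc 0 (1 / (4 * Lx))),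
        ((Real.exp (-(k * lam * (h + 1 / Lθ))) : ℝ) : EReal) *
            (freeEnergy ρ (θ 0) (q 0) - freeEnergyInf ρ) +
          ((h ^ 2 * constB θ q θd xd Lθ Lx / (1 - Real.exp (-(lam * (h + 1 / Lθ)))) : ℝ) :
            EReal) := by
  obtain ⟨fs, hfs_eq, hfs, hPL⟩ := exists_freeEnergyInf_eq hmodel hgrad hlam hxlsi
  have hstep : ∀ k, -Real.log (marginal ρ (θ (k + 2))) = fs ∨ (lam / Lθ < 1 ∧
      -Real.log (marginal ρ (θ (k + 2))) - fs ≤ (1 - lam / Lθ) *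
        ((1 - lam / Lθ) * (-Real.log (marginal ρ (θ (k + 1))) - fs))) := fun k => by
    refine neg_log_marginal_sub_le_of_posterior hmodel hgrad hLθ hlam hfs hPL ?_
    rw [← hEM.eStep k]
    exact hEM.mStep (k + 1)
  have hr0 : 0 < lam / Lθ := by positivity
  have hmono : ∀ k, -Real.log (marginal ρ (θ (k + 1))) ≤ -Real.log (marginal ρ (θ 1)) := by
    intro k
    induction k with
    | zero => exact le_rfl
    | succ k ih =>
      refine le_trans ?_ ih
      have h0 := sub_nonneg.2 (hfs (θ (k + 1)))
      rcases hstep k with h | ⟨h1, h2⟩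
      · rw [h]; exact hfs _
      · have h3 : (1 - lam / Lθ) * (-Real.log (marginal ρ (θ (k + 1))) - fs) ≤
            -Real.log (marginal ρ (θ (k + 1))) - fs := mul_le_of_le_one_left h0 (by linarith)
        have h4 := mul_le_of_le_one_left (mul_nonneg (sub_nonneg.2 h1.le) h0)
          (show 1 - lam / Lθ ≤ 1 by linarith)
        linarith
  have hbdd := bddAbove_iterateSpread hmodel hgrad hlam hfs hPL hEM hmono θd xd
  refine ⟨hbdd, fun k => le_iInf₂ fun h hh => ?_⟩
  set S := ⨆ k, iterateSpread θ q θd xd k with hSdef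
  have hS : ∀ k, iterateSpread θ q θd xd k ≤ S := fun k => le_ciSup hbdd k
  have hS0 : 0 ≤ S :=
    le_trans (add_nonneg (integral_nonneg fun x => sq_nonneg _) (sq_nonneg _)) (hS 0)
  -- The recursion requires only the part Lθ² S Lx/2 of B.
  have hB : Lθ ^ 2 * S * Lx / 2 ≤ constB θ q θd xd Lθ Lx := by
    have h1 : Lθ ^ 2 ≤ (max Lθ Lx) ^ 2 := pow_le_pow_left₀ hLθ.le (le_max_left _ _) 2
    have h2 : Lθ ^ 2 * S * Lx / 2 ≤ (max Lθ Lx) ^ 2 * S * Lx / 2 := by gcongr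
    have h3 : 0 ≤ 8 * Lx ^ 2 * (d : ℝ) := by positivity
    unfold constB constC
    linarith
  have hpost : ∀ k, freeEnergy ρ (θ (k + 1)) (q (k + 1)) =
      (-Real.log (marginal ρ (θ (k + 1))) : ℝ) := fun k => by
    rw [hEM.eStep k, freeEnergy_posterior hmodel hgrad]
  rw [hfs_eq]
  -- If the initial entropy is not finite, the initial free energy is ⊤; multiplied by a positive
  -- exponential, it makes the bound trivial.
  by_cases hlog : Integrable (logDensity (q 0)) (q 0)
  · set F : ℕ → ℝ := fun k => Nat.casesOn k
      ((∫ x, logDensity (q 0) x ∂(q 0)) - ∫ x, logLik ρ (θ 0) x ∂(q 0))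
      fun k => -Real.log (marginal ρ (θ (k + 1))) with hF
    have hFk : ∀ k, freeEnergy ρ (θ k) (q k) = (F k : EReal) := by
      rintro (_ | k)
      · exact freeEnergy_eq_coe hmodel hgrad hEM.init hlog _
      · exact hpost k
    rw [hFk k, hFk 0, ← EReal.coe_sub, ← EReal.coe_sub, ← EReal.coe_mul, ← EReal.coe_add,
      EReal.coe_le_coe_iff]
    refine le_rate_of_contractions (Δ := fun k => F k - fs) hLθ hLx hlam hS0 hB hh.1 ?_ ?_ ?_ ?_ k
    · rintro (_ | k)
      · exact sub_nonneg.2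
          ((hfs (θ 0)).trans (neg_log_marginal_le hmodel hgrad hEM.init hlog (θ 0)))
      · exact sub_nonneg.2 (hfs _)
    · refine (neg_log_marginal_sub_le hmodel hgrad hLθ hlam hfs hPL hEM.init hlog
        (hEM.mStep 0)).imp sub_eq_zero.2 fun ⟨h1, h2⟩ => ⟨h1, h2.trans ?_⟩
      -- The first M-step is used only through monotonicity, as q_0 need not be a posterior; the
      -- factor comes from the E-step.
      have := hEM.mStep 0 (θ 0)
      exact mul_le_mul_of_nonneg_left (sub_le_sub_right (sub_le_sub_left this _) _)
        (sub_nonneg.2 h1.le)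
    · exact fun k => (hstep k).imp sub_eq_zero.2 id
    · intro k
      have h1 := hPL (θ (k + 1))
      rw [← hEM.eStep k] at h1
      have h2 := sq_norm_integral_gradParam_le_of_spread hmodel hgrad hLθ hLx hEM hS k
      rw [le_div_iff₀ hlam]
      have h3 := h1.trans h2
      change (-Real.log (marginal ρ (θ (k + 1))) - fs) * lam ≤ _
      linarith
  · rw [freeEnergy_eq_top hmodel hgrad hEM.init hlog, EReal.top_sub_coe,
      EReal.coe_mul_top_of_pos (Real.exp_pos _), EReal.top_add_coe]
    exact le_top
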